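/- **Lattices.** Consider a rectangular array of unit cells whose edges carry labels. A configuration is *valid* if at every cell the pair of labels on the right and top edges is, in some order, the pair of labels on the left and bottom edges. The partition function with given boundary labels is the sum, over all valid configurations with this boundary, of the product of the weights of the cells. **Wavefunctions.** Let $m,w\in\{0,1\}^P$ be binary strings ($1$ = particle, $0$ = hole) such that $m$ has exactly $n$ more particles than $w$. Define $\mathrm H_{m/w}(x_1,\dots,x_n;y_1,\dots,y_P)$ as the partition function of the array with $P$ rows (numbered from top to bottom, with parameters $y_1,\dots,y_P$) and $n$ columns (numbered from left to right, with parameters $x_1,\dots,x_n$), edge labels in $\{0,1\}$, left boundary $m$, right boundary $w$ (both read from top to bottom), bottom boundary all $0$, top boundary all $1$. A cell in a row with parameter $y$ and a column with parameter $x$, with labels (left, bottom, right, top), has weight $$(1,1,1,1),\ (0,0,0,0)\mapsto 1,\qquad (0,1,0,1)\mapsto \frac{1-xy^{-1}q^{-1}}{1-xy^{-1}},\qquad (1,0,1,0)\mapsto\frac{q(1-xy^{-1}q^{-1})}{1-xy^{-1}},$$ $$(0,1,1,0)\mapsto\frac{(1-q)xy^{-1}q^{-1}}{1-xy^{-1}},\qquad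 (1,0,0,1)\mapsto\frac{1-q}{1-xy^{-1}}.$$ Put $\mathrm H_{m/w}(x_1,\dots,x_n)=\mathrm H_{m/w}(x_1,\dots,x_n;q^{-1},\dots,q^{-1})$, and $\mathrm H_m=\mathrm H_{m/w}$ when $w=(0,\dots,0)$. **Puzzles.** For $m,k\in\{0,1\}^P$ and $l,w\in\{0,1\}^N$ let $C^{k,w}_{l,m}\in\mathbb Z[q]$ be the partition function of the array with $P$ rows and $N$ columns and edge labels W (white), R (red), B (blue), with the following boundary. The $i$-th edge from the top of the left side is R if $m_i=1$ and B if $m_i=0$; the $i$-th edge from the top of the right side is W if $k_i=1$ and B if $k_i=0$; the $j$-th edge *from the right* of the top side is R if $l_j=1$ and W if $l_j=0$; the $j$-th edge from the right of the bottom side is R if $w_j=1$ and W if $w_j=0$. The fifteen possible cells (tiles), written (left, bottom, right, top), have weights - $0$: RRRR, BBBB, WWWW; - $1$: RWRW, WRWR, RWWR, WRRW, BWBW, WBWB, BWWB, WBBW, BRBR; - $q$: RBRB; - $-1$: BRRB; - $-q$: RBBR. **Theorem.** Let $P,N,n\ge 0$, let $m\in\{0,1\}^P$ have exactly $n$ particles,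 and let $l,w\in\{0,1\}^N$ be such that $l$ has exactly $n$ more particles than $w$. 1. Suppose that $m$ ends with sufficiently many holes, namely that $i+j\le P$ whenever $m_i=1$ and $l_j=1$. Then $$\mathrm H_m(x_1,\dots,x_n)\,\mathrm H_{l/w}(x_1,\dots,x_n)=\sum_{k}C^{k,w}_{l,m}(q)\,\mathrm H_k(x_1,\dots,x_n),$$ where the sum is over all $k\in\{0,1\}^P$ with exactly $n$ particles. The identity holds over every field, for all values of $q,x_1,\dots,x_n$ with $q\ne0$ and $qx_i\ne1$ for all $i$; in particular it holds as an identity of rational functions. 2. For every $k\in\{0,1\}^P$, up to an overall sign, $C^{k,w}_{l,m}$ is a polynomial in $q$ with non-negative coefficients. -/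

import Mathlib

open Polynomial

section SixVertex

/-- Conservation at a vertex of a lattice, for edge labels `left`, `bottom` (incoming) and
`right`, `top` (outgoing): the two outgoing labels are the two incoming ones, in some order.
For labels in `Bool` this gives the six vertices of the six-vertex model, and for the labels
white, red, blue the fifteen tiles of a six-vertex puzzle. -/
def Conserves {α : Type*} (left bottom right top : α) : Prop :=
  (left = right ∧ bottom = top) ∨ (left = top ∧ bottom = right)

instance {α : Type*} [DecidableEq α] (left bottom right top : α) :
    Decidable (Conserves left bottom right top) := by
  unfold Conserves; infer_instance

/-- A labelling of the edges of a rectangular lattice with `R` rows, numbered from top to bottom,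
and `C` columns, numbered from left to right. In row `i`, the horizontal edges are
`(c.1 i 0, ..., c.1 i C)` from left to right. In column `j`, the vertical edges are
`(c.2 0 j, ..., c.2 R j)` from top to bottom. -/
abbrev EdgeLabelling (α : Type*) (R C : ℕ) : Type _ :=
  (Fin R → Fin (C + 1) → α) × (Fin (R + 1) → Fin C → α)

/-- The valid configurations with given boundary: labellings satisfying conservation at every
vertex, with prescribed labels on the left and right boundary (read from top to bottom) and on the
bottom and top boundary (read from left to right). -/
def validConfigurations {α : Type*} [Fintype α] [DecidableEq α] {R C : ℕ}
    (left right : Fin R → α) (bottom top : Fin C → α) : Finset (EdgeLabelling α R C) :=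
  Finset.univ.filter fun c =>
    (∀ i, c.1 i 0 = left i) ∧ (∀ i, c.1 i (Fin.last C) = right i) ∧
    (∀ j, c.2 (Fin.last R) j = bottom j) ∧ (∀ j, c.2 0 j = top j) ∧
    ∀ i j, Conserves (c.1 i j.castSucc) (c.2 i.succ j) (c.1 i j.succ) (c.2 i.castSucc j)

/-- The partition function of a rectangular lattice with given boundary. The vertex in row `i` and
column `j` has weight `W i j left bottom right top`. -/
def partitionFunction {α A : Type*} [Fintype α] [DecidableEq α] [CommSemiring A] {R C : ℕ}
    (W : Fin R → Fin C → α → α → α → α → A)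
    (left right : Fin R → α) (bottom top : Fin C → α) : A :=
  ∑ c ∈ validConfigurations left right bottom top, ∏ i, ∏ j,
    W i j (c.1 i j.castSucc) (c.2 i.succ j) (c.1 i j.succ) (c.2 i.castSucc j)

/-- The number of particles of a binary string (`true` is a particle, `false` a hole). -/
def numParticles {P : ℕ} (m : Fin P → Bool) : ℕ :=
  (Finset.univ.filter fun i => m i = true).card

/-- The six vertex weights, with arguments in the order left, bottom, right, top; `x` is attached
to the column and `y` to the row. -/
def vertexWeight {K : Type*} [Field K] (q x y : K) : Bool → Bool → Bool → Bool → K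
  | true, true, true, true => 1
  | false, false, false, false => 1
  | false, true, false, true => (1 - x * y⁻¹ * q⁻¹) / (1 - x * y⁻¹)
  | true, false, true, false => q * (1 - x * y⁻¹ * q⁻¹) / (1 - x * y⁻¹)
  | false, true, true, false => (1 - q) * x * y⁻¹ * q⁻¹ / (1 - x * y⁻¹)
  | true, false, false, true => (1 - q) / (1 - x * y⁻¹)
  | _, _, _, _ => 0

/-- The six-vertex wavefunction `H_{m/w}(x₁, …, xₙ; y₁, …, y_P)`: the partition function with left
boundary `m`, right boundary `w`, holes on the bottom and particles on the top. -/
def waveFunctionXY {K : Type*} [Field K] (q : K) {P n : ℕ} (m w : Fin P → Bool)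
    (x : Fin n → K) (y : Fin P → K) : K :=
  partitionFunction (fun i j => vertexWeight q (x j) (y i)) m w (fun _ => false) (fun _ => true)

/-- `H_{m/w}(x₁, …, xₙ)`, the specialization of all `yᵢ` to `q⁻¹`. -/
def skewWaveFunction {K : Type*} [Field K] (q : K) {P n : ℕ} (m w : Fin P → Bool)
    (x : Fin n → K) : K :=
  waveFunctionXY q m w x fun _ => q⁻¹

/-- `H_m(x₁, …, xₙ)`, the case where `w` consists of holes. -/
def waveFunction {K : Type*} [Field K] (q : K) {P n : ℕ} (m : Fin P → Bool) (x : Fin n → K) : K :=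
  skewWaveFunction q m (fun _ => false) x

/-- The edge labels of a six-vertex puzzle. -/
inductive PuzzleLabel : Type
  | white
  | red
  | blue
  deriving DecidableEq

namespace PuzzleLabel

instance : Fintype PuzzleLabel := ⟨{white, red, blue}, fun a => by cases a <;> decide⟩

/-- The tiles of a six-vertex puzzle, that is the label patterns satisfying conservation, are
fifteen in number. -/
theorem card_tiles : (Finset.univ.filter
    fun t : PuzzleLabel × PuzzleLabel × PuzzleLabel × PuzzleLabel =>
      Conserves t.1 t.2.1 t.2.2.1 t.2.2.2).card = 15 := by
  decide

/-- The weights of the fifteen tiles, with arguments in the order left, bottom, right, top. The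
last line covers the label patterns which violate conservation and hence are not tiles. -/
def tileWeight {A : Type*} [CommRing A] (q : A) :
    PuzzleLabel → PuzzleLabel → PuzzleLabel → PuzzleLabel → A
  | red, red, red, red => 0
  | red, white, red, white => 1
  | white, red, white, red => 1
  | red, white, white, red => 1
  | white, red, red, white => 1
  | blue, blue, blue, blue => 0
  | blue, white, blue, white => 1
  | white, blue, white, blue => 1
  | blue, white, white, blue => 1
  | white, blue, blue, white => 1
  | white, white, white, white => 0
  | blue, red, blue, red => 1
  | red, blue, red, blue => q
  | blue, red, red, blue => -1
  | red, blue, blue, red => -q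
  | _, _, _, _ => 0

/-- Colouring of the top and bottom boundary strings. -/
def redWhite (b : Bool) : PuzzleLabel := if b then red else white

/-- Colouring of the left boundary string. -/
def redBlue (b : Bool) : PuzzleLabel := if b then red else blue

/-- Colouring of the right boundary string. -/
def whiteBlue (b : Bool) : PuzzleLabel := if b then white else blue

end PuzzleLabel

/-- The coefficient `C^{k,w}_{l,m}`, as a polynomial in `q` with integer coefficients: the partition
function of six-vertex puzzles with `P` rows and `N` columns, with left boundary `m` and right
boundary `k` read from top to bottom, and with top boundary `l` and bottom boundary `w` read from
right to left. -/
noncomputable def puzzleCoeff {P N : ℕ} (k : Fin P → Bool) (w l : Fin N → Bool)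
    (m : Fin P → Bool) : ℤ[X] :=
  partitionFunction (fun _ _ => PuzzleLabel.tileWeight (X : ℤ[X]))
    (fun i => PuzzleLabel.redBlue (m i)) (fun i => PuzzleLabel.whiteBlue (k i))
    (fun j => PuzzleLabel.redWhite (w j.rev)) (fun j => PuzzleLabel.redWhite (l j.rev))

end SixVertex

/-! The lines carrying the parameters `x` can be pulled through a puzzle by the Yang–Baxter
equation, and the boundary conditions freeze one of the three crossings before and one after.
Before, the two others contribute `H_m` and `H_{l/w}`; after, they contribute the puzzles with right
boundary `k` and the wavefunctions `H_k`, where the holes at the end of `m` keep blue labels off the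
bottom of the puzzle.

The parity of the sign of a tile, suitably extended to the tiles of weight zero, is additive along
rows: its sum over a row depends only on the four boundaries of the row, through statistics that
cancel between consecutive rows or are fixed by conservation. Hence all puzzles with the same
boundary carry the same sign.
-/

section TransferMatrices

open scoped Kronecker

variable {A : Type*} [CommSemiring A]

theorem semiconjBy_prod_ofFn {M : Type*} [Monoid M] {n : ℕ} {a : M} {x y : Fin n → M}
    (h : ∀ i, SemiconjBy a (x i) (y i)) :
    SemiconjBy a (List.ofFn x).prod (List.ofFn y).prod := by
  induction n with
  | zero => simp
  | succ n ih =>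
    simp only [List.ofFn_succ, List.prod_cons]
    exact (h 0).mul_right (ih fun i => h i.succ)

theorem prod_ofFn_kronecker {S T : Type*} [Fintype S] [DecidableEq S] [Fintype T] [DecidableEq T]
    {n : ℕ} (M : Fin n → Matrix S S A) (M' : Fin n → Matrix T T A) :
    (List.ofFn fun i => M i ⊗ₖ M' i).prod = (List.ofFn M).prod ⊗ₖ (List.ofFn M').prod := by
  induction n with
  | zero => simp
  | succ n ih => simp only [List.ofFn_succ, List.prod_cons, ih, Matrix.mul_kronecker_mul]

theorem prod_ofFn_sum {B D : Type*} [Semiring B] [Fintype D] {n : ℕ} (f : Fin n → D → B) :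
    (List.ofFn fun i => ∑ d, f i d).prod = ∑ u : Fin n → D, (List.ofFn fun i => f i (u i)).prod :=
  (MultilinearMap.mkPiAlgebraFin ℕ n B).map_sum f

theorem sum_fin_succ_fun {S B : Type*} [Fintype S] [AddCommMonoid B] {n : ℕ}
    (F : (Fin (n + 1) → S) → B) : ∑ h, F h = ∑ s, ∑ g : Fin n → S, F (Fin.cons s g) := by
  rw [← (Fin.consEquiv fun _ : Fin (n + 1) => S).sum_comp F, Fintype.sum_prod_type]
  rfl

theorem prod_ofFn_apply {S : Type*} [Fintype S] [DecidableEq S] {n : ℕ}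
    (M : Fin n → Matrix S S A) (s e : S) :
    (List.ofFn M).prod s e = ∑ h : Fin (n + 1) → S,
      if h 0 = s ∧ h (Fin.last n) = e then ∏ j, M j (h j.castSucc) (h j.succ) else 0 := by
  induction n generalizing s with
  | zero => simp [sum_fin_succ_fun, Matrix.one_apply, ite_and]
  | succ n ih =>
    simp only [List.ofFn_succ, List.prod_cons, Matrix.mul_apply, ih, Finset.mul_sum]
    symm
    rw [sum_fin_succ_fun, Finset.sum_eq_single s (fun s' _ hs => by simp [hs]) (by simp),
      Finset.sum_comm]
    refine Finset.sum_congr rfl fun g _ => ?_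
    rw [Finset.sum_eq_single (g 0) (fun s' _ hs => by simp [hs.symm]) (by simp)]
    simp [Fin.prod_univ_succ, ← Fin.succ_last]

/-- The matrix, indexed by the labels of the horizontal line, formed by the weights of a vertex
with given labels below and above. -/
def horizontalMatrix {α β : Type*} (W : α → β → α → β → A) (bottom top : β) :
    Matrix α α A :=
  Matrix.of fun left right => W left bottom right top

/-- The matrix of the crossing of two lines, from the pair of incoming to the pair of outgoing
labels. -/
def crossingMatrix {α ξ : Type*} (U : α → ξ → α → ξ → A) : Matrix (α × ξ) (α × ξ) A :=
  Matrix.of fun p r => U p.1 p.2 r.1 r.2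

/-- A vertex weight after a counterclockwise quarter turn of the vertex. A line running from left
to right then runs from bottom to top, and one running from bottom to top is read backwards. -/
def quarterTurn {α β : Type*} (W : α → β → α → β → A) : β → α → β → α → A :=
  fun left bottom right top => W bottom right top left

/-- The partition function of a row of vertices: a horizontal line with labels in `α` crossing a
bundle of vertical lines with labels in `β`. -/
def rowWeight {α β : Type*} [Fintype α] [DecidableEq α] {n : ℕ}
    (W : Fin n → α → β → α → β → A) (left : α) (bottom : Fin n → β) (right : α)
    (top : Fin n → β) : A :=
  (List.ofFn fun j => horizontalMatrix (W j) (bottom j) (top j)).prod left right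

/-- The partition function of a column of vertices: a bundle of horizontal lines with labels in
`α` crossing a vertical line with labels in `β`. -/
def columnWeight {α β : Type*} [Fintype β] [DecidableEq β] {n : ℕ}
    (W : Fin n → α → β → α → β → A) (left : Fin n → α) (bottom : β) (right : Fin n → α)
    (top : β) : A :=
  rowWeight (fun i => quarterTurn (W i)) top left bottom right

/-- The partition function of a rectangular lattice as a transfer matrix element. Unlike for
`partitionFunction`, the horizontal and the vertical lines may carry labels of different types. -/
def latticeWeight {α β : Type*} [Fintype α] [DecidableEq α] [Fintype β] [DecidableEq β] {R C : ℕ}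
    (W : Fin R → Fin C → α → β → α → β → A) :
    (Fin R → α) → (Fin C → β) → (Fin R → α) → (Fin C → β) → A :=
  columnWeight fun i => rowWeight (W i)

/-- The Yang–Baxter equation for the three crossings of lines labelled by `α`, `ξ` and `β`. -/
def YangBaxter {α ξ β : Type*} [Fintype α] [Fintype ξ] [Fintype β]
    (U : α → ξ → α → ξ → A) (V : α → β → α → β → A) (W : ξ → β → ξ → β → A) : Prop :=
  ∀ a x b a'' x'' b'',
    ∑ a', ∑ x', ∑ b', U a x a' x' * V a' b a'' b' * W x' b' x'' b'' =
    ∑ a', ∑ x', ∑ b', W x b x' b' * V a b' a' b'' * U a' x' a'' x''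

namespace YangBaxter

variable {α ξ β : Type*} [Fintype α] [Fintype ξ] [Fintype β]

theorem iff_semiconjBy {U : α → ξ → α → ξ → A} {V : α → β → α → β → A} {W : ξ → β → ξ → β → A} :
    YangBaxter U V W ↔ ∀ b b'', SemiconjBy (crossingMatrix U)
      (∑ b', horizontalMatrix V b b' ⊗ₖ horizontalMatrix W b' b'')
      (∑ b', horizontalMatrix V b' b'' ⊗ₖ horizontalMatrix W b b') := by
  have entry (a x b a'' x'' b'') :
      (∑ a', ∑ x', ∑ b', U a x a' x' * V a' b a'' b' * W x' b' x'' b'' =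
        ∑ a', ∑ x', ∑ b', W x b x' b' * V a b' a' b'' * U a' x' a'' x'') ↔
      (crossingMatrix U * ∑ b', horizontalMatrix V b b' ⊗ₖ horizontalMatrix W b' b'')
          (a, x) (a'', x'') =
        ((∑ b', horizontalMatrix V b' b'' ⊗ₖ horizontalMatrix W b b') * crossingMatrix U)
          (a, x) (a'', x'') := by
    simp only [crossingMatrix, horizontalMatrix, Matrix.mul_apply, Matrix.sum_apply,
      Matrix.kronecker_apply, Matrix.of_apply, Fintype.sum_prod_type, Finset.mul_sum,
      mul_left_comm, mul_comm]
  constructor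
  · intro h b b''
    ext ⟨a, x⟩ ⟨a'', x''⟩
    exact (entry a x b a'' x'' b'').mp (h a x b a'' x'' b'')
  · intro h a x b a'' x'' b''
    exact (entry a x b a'' x'' b'').mpr (congrFun₂ (h b b'') (a, x) (a'', x''))

theorem quarterTurn_iff {U : α → ξ → α → ξ → A} {V : α → β → α → β → A} {W : ξ → β → ξ → β → A} :
    YangBaxter (quarterTurn V) (quarterTurn W) U ↔ YangBaxter U V W := by
  have rot {S T R : Type _} [Fintype S] [Fintype T] [Fintype R] (F : S → T → R → A) :
      ∑ s, ∑ t, ∑ r, F s t r = ∑ t, ∑ r, ∑ s, F s t r := by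
    rw [Finset.sum_comm]
    exact Finset.sum_congr rfl fun _ _ => Finset.sum_comm
  have entry (a x b a'' x'' b'') :
      (∑ b', ∑ a', ∑ x', quarterTurn V b'' a b' a' * quarterTurn W b' x b x' * U a' x' a'' x'' =
        ∑ b', ∑ a', ∑ x', U a x a' x' * quarterTurn W b'' x' b' x'' * quarterTurn V b' a' b a'') ↔
      (∑ a', ∑ x', ∑ b', U a x a' x' * V a' b a'' b' * W x' b' x'' b'' =
        ∑ a', ∑ x', ∑ b', W x b x' b' * V a b' a' b'' * U a' x' a'' x'') := by
    rw [rot, rot, eq_comm]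
    simp only [quarterTurn, mul_left_comm, mul_comm]
  exact ⟨fun h a x b a'' x'' b'' => (entry a x b a'' x'' b'').mp (h b'' a x b a'' x''),
    fun h b'' a x b a'' x'' => (entry a x b a'' x'' b'').mpr (h a x b a'' x'' b'')⟩

theorem fuse_vertical [DecidableEq α] [DecidableEq ξ] {n : ℕ} {U : α → ξ → α → ξ → A}
    {V : Fin n → α → β → α → β → A} {W : Fin n → ξ → β → ξ → β → A}
    (h : ∀ j, YangBaxter U (V j) (W j)) :
    YangBaxter U (rowWeight V) (rowWeight W) := by
  refine iff_semiconjBy.mpr fun u u'' => ?_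
  have fused := semiconjBy_prod_ofFn fun j => iff_semiconjBy.mp (h j) (u j) (u'' j)
  simp only [prod_ofFn_sum, prod_ofFn_kronecker] at fused
  exact fused

theorem fuse_middle [DecidableEq α] [DecidableEq β] {n : ℕ} {U : Fin n → α → ξ → α → ξ → A}
    {V : α → β → α → β → A} {W : Fin n → ξ → β → ξ → β → A} (h : ∀ k, YangBaxter (U k) V (W k)) :
    YangBaxter (rowWeight U) V (columnWeight W) :=
  quarterTurn_iff.mp (fuse_vertical fun k => quarterTurn_iff.mpr (h k))

theorem fuse_horizontal [DecidableEq ξ] [DecidableEq β] {n : ℕ} {U : Fin n → α → ξ → α → ξ → A}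
    {V : Fin n → α → β → α → β → A} {W : ξ → β → ξ → β → A} (h : ∀ i, YangBaxter (U i) (V i) W) :
    YangBaxter (columnWeight U) (columnWeight V) W :=
  quarterTurn_iff.mp <| quarterTurn_iff.mp <| fuse_vertical fun i =>
    quarterTurn_iff.mpr <| quarterTurn_iff.mpr (h i)

theorem fuse_lattice [DecidableEq α] [DecidableEq ξ] [DecidableEq β] {P n N : ℕ}
    {U : Fin P → Fin n → α → ξ → α → ξ → A} {V : Fin P → Fin N → α → β → α → β → A}
    {W : Fin n → Fin N → ξ → β → ξ → β → A} (h : ∀ i k j, YangBaxter (U i k) (V i j) (W k j)) :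
    YangBaxter (latticeWeight U) (latticeWeight V) (latticeWeight W) :=
  fuse_horizontal fun i => fuse_middle fun k => fuse_vertical fun j => h i k j

end YangBaxter

end TransferMatrices

section Configurations

variable {α : Type*}

theorem Conserves.straight_of_ne {left bottom right top : α} (h : Conserves left bottom right top)
    (hne : left ≠ top) : left = right ∧ bottom = top :=
  h.resolve_right fun h' => hne h'.1

theorem Conserves.outgoing_mem {left bottom right top : α} (h : Conserves left bottom right top)
    {S : Set α} (hl : left ∈ S) (hb : bottom ∈ S) : right ∈ S ∧ top ∈ S := by
  rcases h with ⟨rfl, rfl⟩ | ⟨rfl, rfl⟩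
  exacts [⟨hl, hb⟩, ⟨hb, hl⟩]

theorem conserves_map_iff {δ : Type*} {φ : δ → α} (hφ : Function.Injective φ) {a b a' b' : δ} :
    Conserves (φ a) (φ b) (φ a') (φ b') ↔ Conserves a b a' b' := by
  simp only [Conserves, hφ.eq_iff]

/-- Conservation at every vertex of a row with horizontal labels `h` from left to right. -/
def ConservesRow {n : ℕ} (h : Fin (n + 1) → α) (bottom top : Fin n → α) : Prop :=
  ∀ j, Conserves (h j.castSucc) (bottom j) (h j.succ) (top j)

namespace ConservesRow

variable {n : ℕ} {h : Fin (n + 1) → α} {bottom top : Fin n → α}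

theorem eq_left (hc : ConservesRow h bottom top) {k : Fin (n + 1)}
    (ht : ∀ j : Fin n, j.castSucc < k → top j ≠ h 0) : h k = h 0 := by
  induction k using Fin.induction with
  | zero => rfl
  | succ j ih =>
    have hj : h j.castSucc = h 0 := ih fun i hi => ht i (hi.trans j.castSucc_lt_succ)
    rw [← hj] at ht ⊢
    exact ((hc j).straight_of_ne (ht j j.castSucc_lt_succ).symm).1.symm

theorem bottom_eq_top (hc : ConservesRow h bottom top) {j : Fin n}
    (ht : ∀ i ≤ j, top i ≠ h 0) : bottom j = top j := by
  have hj : h j.castSucc = h 0 := hc.eq_left fun i hi => ht i hi.le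
  exact ((hc j).straight_of_ne (hj ▸ (ht j le_rfl).symm)).2

theorem labels_mem (hc : ConservesRow h bottom top) {S : Set α} (h0 : h 0 ∈ S)
    (hb : ∀ j, bottom j ∈ S) : (∀ k, h k ∈ S) ∧ ∀ j, top j ∈ S := by
  have hh : ∀ k, h k ∈ S :=
    Fin.induction h0 fun j hj => ((hc j).outgoing_mem hj (hb j)).1
  exact ⟨hh, fun j => ((hc j).outgoing_mem (hh _) (hb j)).2⟩

end ConservesRow

variable [Fintype α] [DecidableEq α] {R C : ℕ} {left right : Fin R → α} {bottom top : Fin C → α}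
  {c : EdgeLabelling α R C}

theorem mem_validConfigurations : c ∈ validConfigurations left right bottom top ↔
    (∀ i, c.1 i 0 = left i) ∧ (∀ i, c.1 i (Fin.last C) = right i) ∧ c.2 (Fin.last R) = bottom ∧
      c.2 0 = top ∧ ∀ i, ConservesRow (c.1 i) (c.2 i.succ) (c.2 i.castSucc) := by
  simp only [validConfigurations, Finset.mem_filter, Finset.mem_univ, true_and, funext_iff,
    ConservesRow]

theorem labels_mem_of_mem_validConfigurations (hc : c ∈ validConfigurations left right bottom top)
    {S : Set α} (hl : ∀ i, left i ∈ S) (hb : ∀ j, bottom j ∈ S) :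
    (∀ i k, c.1 i k ∈ S) ∧ ∀ i j, c.2 i j ∈ S := by
  obtain ⟨c_left, -, c_bottom, -, rows⟩ := mem_validConfigurations.mp hc
  have row_mem (i : Fin R) (hi : ∀ j, c.2 i.succ j ∈ S) :=
    (rows i).labels_mem (c_left i ▸ hl i) hi
  have vertical_mem : ∀ i j, c.2 i j ∈ S :=
    Fin.reverseInduction (c_bottom ▸ hb) fun i hi => (row_mem i hi).2
  exact ⟨fun i => (row_mem i (vertical_mem _)).1, vertical_mem⟩

theorem eq_of_mem_validConfigurations_of_frozen {X : α}
    (hc : c ∈ validConfigurations (fun _ => X) right bottom top) (ht : ∀ j, top j ≠ X) :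
    c = (fun _ _ => X, fun _ => top) := by
  obtain ⟨c_left, -, -, c_top, rows⟩ := mem_validConfigurations.mp hc
  have vertical_eq (i) : c.2 i = top := by
    induction i using Fin.induction with
    | zero => exact c_top
    | succ i ih =>
      rw [← ih]
      exact funext fun j => (rows i).bottom_eq_top fun k _ => by rw [ih, c_left]; exact ht k
  have horizontal_eq (i k) : c.1 i k = X := by
    rw [← c_left i]
    exact (rows i).eq_left fun j _ => by rw [vertical_eq, c_left]; exact ht j
  exact Prod.ext (funext₂ horizontal_eq) (funext vertical_eq)

theorem vertical_eq_of_top_eq {Y : α} (hc : c ∈ validConfigurations left right bottom top)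
    (hl : ∀ i, left i ≠ Y) {j : Fin C} (ht : ∀ j' ≤ j, top j' = Y) (i : Fin (R + 1)) :
    ∀ j' ≤ j, c.2 i j' = Y := by
  obtain ⟨c_left, -, -, c_top, rows⟩ := mem_validConfigurations.mp hc
  induction i using Fin.induction with
  | zero => exact c_top ▸ ht
  | succ i ih =>
    intro j' hj'
    rw [← ih j' hj']
    refine (rows i).bottom_eq_top fun k hk => ?_
    rw [ih k (hk.trans hj'), c_left]
    exact (hl i).symm

/-- A label `X` entering row `i` from the left runs straight along it until it meets an
outgoing vertical `X`, so each such row pushes the region free of vertical `X` one column further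
to the right. -/
theorem bottom_ne_of_left_eventually_eq {X Y : α}
    (hc : c ∈ validConfigurations left right bottom top)
    (hXX : ∀ i j, c.1 i j.castSucc = X → c.2 i.succ j ≠ X) (hXY : X ≠ Y) (hl : ∀ i, left i ≠ Y)
    (ht : ∀ j, top j ≠ X) (hlt : ∀ i j, left i ≠ X → top j ≠ Y → (i + 1 : ℕ) + (C - j) ≤ R) :
    ∀ j, bottom j ≠ X := by
  obtain ⟨c_left, -, c_bottom, c_top, rows⟩ := mem_validConfigurations.mp hc
  have free (i : Fin (R + 1)) : ∀ j : Fin C, (j + R : ℕ) < i + C → c.2 i j ≠ X := by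
    induction i using Fin.induction with
    | zero => exact fun j _ => c_top ▸ ht j
    | succ i ih =>
      intro j hj
      rw [Fin.val_succ] at hj
      by_cases hY : ∀ j' ≤ j, top j' = Y
      · rw [vertical_eq_of_top_eq hc hl hY i.succ j le_rfl]
        exact hXY.symm
      · push Not at hY
        obtain ⟨j', hj', hY⟩ := hY
        have left_eq : left i = X := by
          by_contra hX
          have := hlt i j' hX hY
          omega
        have horizontal_eq : c.1 i j.castSucc = X := by
          rw [← left_eq, ← c_left]
          refine (rows i).eq_left fun k hk => ?_
          rw [c_left, left_eq]
          exact ih k (by rw [Fin.val_castSucc]; have : (k : ℕ) < j := hk; omega)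
        exact hXX i j horizontal_eq
  intro j
  rw [← c_bottom]
  exact free _ j (by rw [Fin.val_last]; omega)

end Configurations

section LabelCounts

theorem add_sum_eq_add_sum_of_step {M : Type*} [AddCommMonoid M] {n : ℕ} {f : Fin (n + 1) → M}
    {g g' : Fin n → M} (h : ∀ i, f i.castSucc + g i = f i.succ + g' i) :
    f 0 + ∑ i, g i = f (Fin.last n) + ∑ i, g' i := by
  induction n with
  | zero => simp
  | succ n ih =>
    have first := ih (f := fun i => f i.castSucc) fun i => h i.castSucc
    rw [Fin.sum_univ_castSucc, Fin.sum_univ_castSucc, ← add_assoc]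
    rw [Fin.castSucc_zero] at first
    rw [first, add_right_comm, h, ← Fin.succ_last, add_right_comm, add_assoc]

variable {α : Type*} [DecidableEq α]

/-- The contribution of a single edge to the number of edges labelled `X`. -/
def labelIndicator (X a : α) : ℕ := if a = X then 1 else 0

/-- The number of edges of a boundary with label `X`. -/
def labelCount {n : ℕ} (X : α) (u : Fin n → α) : ℕ := ∑ i, labelIndicator X (u i)

theorem labelCount_succ {n : ℕ} (X : α) (u : Fin (n + 1) → α) :
    labelCount X u = labelIndicator X (u 0) + labelCount X fun i => u i.succ :=
  Fin.sum_univ_succ _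

theorem labelCount_eq_card {n : ℕ} (X : α) (u : Fin n → α) :
    labelCount X u = (Finset.univ.filter fun i => u i = X).card :=
  (Finset.card_filter _ _).symm

theorem labelCount_eq_zero {n : ℕ} {X : α} {u : Fin n → α} :
    labelCount X u = 0 ↔ ∀ i, u i ≠ X := by
  simp [labelCount_eq_card, Finset.filter_eq_empty_iff]

theorem labelCount_const_of_ne {n : ℕ} {X Y : α} (h : Y ≠ X) :
    labelCount X (fun _ : Fin n => Y) = 0 :=
  labelCount_eq_zero.mpr fun _ => h

theorem labelCount_le {n : ℕ} (X : α) (u : Fin n → α) : labelCount X u ≤ n := by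
  rw [labelCount_eq_card]
  exact card_finset_fin_le _

theorem labelCount_eq_length {n : ℕ} {X : α} {u : Fin n → α} :
    labelCount X u = n ↔ u = fun _ => X := by
  have full := Finset.card_filter_eq_iff (s := Finset.univ) (p := fun i => u i = X)
  rw [Finset.card_fin] at full
  simp [labelCount_eq_card, full, funext_iff]

theorem labelCount_map {δ : Type*} [DecidableEq δ] {φ : δ → α} (hφ : Function.Injective φ) {n : ℕ}
    (X : δ) (u : Fin n → δ) : labelCount (φ X) (fun i => φ (u i)) = labelCount X u := by
  simp only [labelCount, labelIndicator, hφ.eq_iff]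

protected theorem Conserves.labelIndicator {left bottom right top : α}
    (h : Conserves left bottom right top) (X : α) :
    labelIndicator X left + labelIndicator X bottom =
      labelIndicator X right + labelIndicator X top := by
  rcases h with ⟨rfl, rfl⟩ | ⟨rfl, rfl⟩
  exacts [rfl, add_comm _ _]

protected theorem ConservesRow.labelCount {n : ℕ} {h : Fin (n + 1) → α} {bottom top : Fin n → α}
    (hc : ConservesRow h bottom top) (X : α) :
    labelIndicator X (h 0) + labelCount X bottom =
      labelIndicator X (h (Fin.last n)) + labelCount X top :=
  add_sum_eq_add_sum_of_step (f := fun k => labelIndicator X (h k)) fun j =>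
    (hc j).labelIndicator X

variable [Fintype α] {R C : ℕ} {left right : Fin R → α} {bottom top : Fin C → α}
  {c d : EdgeLabelling α R C}

theorem labelCount_of_mem_validConfigurations
    (hc : c ∈ validConfigurations left right bottom top) (X : α) :
    labelCount X left + labelCount X bottom = labelCount X right + labelCount X top := by
  obtain ⟨c_left, c_right, rfl, rfl, rows⟩ := mem_validConfigurations.mp hc
  have lattice := add_sum_eq_add_sum_of_step (f := fun i => labelCount X (c.2 i))
    (g := fun i => labelIndicator X (right i)) (g' := fun i => labelIndicator X (left i))
    fun i => by
      rw [← c_left, ← c_right, add_comm, add_comm (labelCount _ _)]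
      exact ((rows i).labelCount X).symm
  rw [add_comm, add_comm (labelCount X right)]
  exact lattice.symm

theorem labelCount_vertical_eq (hc : c ∈ validConfigurations left right bottom top)
    (hd : d ∈ validConfigurations left right bottom top) (X : α) (i : Fin (R + 1)) :
    labelCount X (c.2 i) = labelCount X (d.2 i) := by
  obtain ⟨c_left, c_right, -, c_top, c_rows⟩ := mem_validConfigurations.mp hc
  obtain ⟨d_left, d_right, -, d_top, d_rows⟩ := mem_validConfigurations.mp hd
  induction i using Fin.induction with
  | zero => rw [c_top, d_top]
  | succ i ih =>
    have c_row := (c_rows i).labelCount X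
    have d_row := (d_rows i).labelCount X
    rw [c_left, c_right] at c_row
    rw [d_left, d_right] at d_row
    omega

end LabelCounts

section PartitionFunctions

variable {A : Type*} [CommSemiring A] {α : Type*} [Fintype α] [DecidableEq α] {R C : ℕ}
  {W : Fin R → Fin C → α → α → α → α → A} {left right : Fin R → α} {bottom top : Fin C → α}

theorem exists_configuration_of_partitionFunction_ne_zero
    (h : partitionFunction W left right bottom top ≠ 0) :
    ∃ c ∈ validConfigurations left right bottom top, ∀ i j,
      W i j (c.1 i j.castSucc) (c.2 i.succ j) (c.1 i j.succ) (c.2 i.castSucc j) ≠ 0 := by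
  obtain ⟨c, hc, hW⟩ := Finset.exists_ne_zero_of_sum_ne_zero h
  exact ⟨c, hc, fun i j hz => hW <| Finset.prod_eq_zero (Finset.mem_univ i) <|
    Finset.prod_eq_zero (Finset.mem_univ j) hz⟩

theorem labelCount_of_partitionFunction_ne_zero
    (h : partitionFunction W left right bottom top ≠ 0) (X : α) :
    labelCount X left + labelCount X bottom = labelCount X right + labelCount X top :=
  let ⟨_, hc, _⟩ := exists_configuration_of_partitionFunction_ne_zero h
  labelCount_of_mem_validConfigurations hc X

theorem partitionFunction_of_frozen {X : α} (hW : ∀ i j, ∀ y ≠ X, W i j X y X y = 1)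
    (ht : ∀ j, top j ≠ X) : partitionFunction W (fun _ => X) right bottom top =
      if right = (fun _ => X) ∧ bottom = top then 1 else 0 := by
  split_ifs with boundary
  · obtain ⟨rfl, rfl⟩ := boundary
    have unique : validConfigurations (fun _ => X) (fun _ => X) bottom bottom =
        {(fun (_ : Fin R) _ => X, fun _ => bottom)} := by
      refine Finset.eq_singleton_iff_unique_mem.mpr
        ⟨?_, fun c hc => eq_of_mem_validConfigurations_of_frozen hc ht⟩
      exact mem_validConfigurations.mpr
        ⟨fun _ => rfl, fun _ => rfl, rfl, rfl, fun _ _ => Or.inl ⟨rfl, rfl⟩⟩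
    rw [partitionFunction, unique, Finset.sum_singleton]
    exact Finset.prod_eq_one fun i _ => Finset.prod_eq_one fun j _ => hW i j _ (ht j)
  · refine Finset.sum_eq_zero fun c hc => absurd ?_ boundary
    obtain ⟨-, c_right, c_bottom, -, -⟩ := mem_validConfigurations.mp hc
    rw [eq_of_mem_validConfigurations_of_frozen hc ht] at c_right c_bottom
    exact ⟨funext fun i => (c_right i).symm, c_bottom.symm⟩

theorem partitionFunction_map {δ : Type*} [Fintype δ] [DecidableEq δ] {φ : δ → α}
    (hφ : Function.Injective φ) (left right : Fin R → δ) (bottom top : Fin C → δ) :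
    partitionFunction (fun i j a b a' b' => W i j (φ a) (φ b) (φ a') (φ b')) left right bottom top =
      partitionFunction W (fun i => φ (left i)) (fun i => φ (right i)) (fun j => φ (bottom j))
        (fun j => φ (top j)) := by
  refine Finset.sum_nbij (fun c => (fun i k => φ (c.1 i k), fun i j => φ (c.2 i j)))
    (fun c hc => ?_) (fun c _ d _ hcd => ?_) (fun c hc => ?_) fun _ _ => rfl
  · simp only [validConfigurations, Finset.mem_filter, Finset.mem_univ, true_and, hφ.eq_iff,
      conserves_map_iff hφ] at hc ⊢
    exact hc
  · simpa only [Prod.ext_iff, funext_iff, hφ.eq_iff] using hcd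
  · obtain ⟨horizontal, vertical⟩ := labels_mem_of_mem_validConfigurations hc
      (S := Set.range φ) (fun i => ⟨left i, rfl⟩) fun j => ⟨bottom j, rfl⟩
    choose h hh using horizontal
    choose v hv using vertical
    obtain rfl : c = (fun i k => φ (h i k), fun i j => φ (v i j)) := by
      simp only [hh, hv]
    refine ⟨(h, v), ?_, rfl⟩
    simpa only [validConfigurations, Finset.coe_filter, Set.mem_ofPred_eq, Finset.mem_univ,
      true_and, hφ.eq_iff, conserves_map_iff hφ] using hc

/-- A vertex weight vanishing at the label patterns which violate conservation. -/
def Conserving {A : Type*} [Zero A] {α : Type*} (W : α → α → α → α → A) : Prop :=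
  ∀ a b a' b', W a b a' b' ≠ 0 → Conserves a b a' b'

theorem partitionFunction_eq_latticeWeight (hW : ∀ i j, Conserving (W i j)) :
    partitionFunction W left right bottom top = latticeWeight W left bottom right top := by
  have drop_conservation : partitionFunction W left right bottom top =
      ∑ v : Fin (R + 1) → Fin C → α, ∑ h : Fin R → Fin (C + 1) → α,
        if (v 0 = top ∧ v (Fin.last R) = bottom) ∧
          ∀ i, h i 0 = left i ∧ h i (Fin.last C) = right i then
        ∏ i, ∏ j, W i j (h i j.castSucc) (v i.succ j) (h i j.succ) (v i.castSucc j) else 0 := by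
    rw [partitionFunction, validConfigurations, Finset.sum_filter, Fintype.sum_prod_type,
      Finset.sum_comm]
    refine Finset.sum_congr rfl fun v _ => Finset.sum_congr rfl fun h _ => ?_
    by_cases hc : ∀ i j,
      Conserves (h i j.castSucc) (v i.succ j) (h i j.succ) (v i.castSucc j)
    · refine if_congr ?_ rfl rfl
      simp only [hc, implies_true, and_true, funext_iff, forall_and]
      tauto
    · rw [if_neg fun boundary => hc boundary.2.2.2.2]
      push Not at hc
      obtain ⟨i, j, hij⟩ := hc
      rw [Finset.prod_eq_zero (Finset.mem_univ i) <| Finset.prod_eq_zero (Finset.mem_univ j) <|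
        not_not.mp <| mt (hW i j _ _ _ _) hij, ite_self]
  rw [drop_conservation, latticeWeight, columnWeight, rowWeight, prod_ofFn_apply]
  refine Finset.sum_congr rfl fun v _ => ?_
  simp only [horizontalMatrix, quarterTurn, rowWeight, Matrix.of_apply, prod_ofFn_apply,
    Finset.prod_univ_sum, Fintype.piFinset_univ, Finset.prod_ite_zero, Finset.mem_univ,
    true_imp_iff, ite_and (v 0 = top ∧ v (Fin.last R) = bottom), Finset.sum_ite_irrel,
    Finset.sum_const_zero]

theorem YangBaxter.partitionFunction {P n N : ℕ} {U : Fin P → Fin n → α → α → α → α → A}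
    {V : Fin P → Fin N → α → α → α → α → A} {W : Fin n → Fin N → α → α → α → α → A}
    (hU : ∀ i k, Conserving (U i k)) (hV : ∀ i j, Conserving (V i j))
    (hW : ∀ k j, Conserving (W k j)) (h : ∀ i k j, YangBaxter (U i k) (V i j) (W k j)) :
    YangBaxter (fun left bottom right top => partitionFunction U left right bottom top)
      (fun left bottom right top => partitionFunction V left right bottom top)
      (fun left bottom right top => partitionFunction W left right bottom top) := by
  simp only [partitionFunction_eq_latticeWeight hU, partitionFunction_eq_latticeWeight hV,
    partitionFunction_eq_latticeWeight hW]
  exact YangBaxter.fuse_lattice h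

/-- The quarter turn of a configuration, combined with the inversion of the vertical labels, which
become horizontal. -/
def rotateConfiguration (R C : ℕ) : EdgeLabelling Bool R C ≃ EdgeLabelling Bool C R where
  toFun c := (fun i p => !(c.2 p.rev i), fun p j => c.1 j.rev p)
  invFun c := (fun i p => c.2 p i.rev, fun p j => !(c.1 j p.rev))
  left_inv c := by simp
  right_inv c := by simp

theorem partitionFunction_rotate (W : Fin R → Fin C → Bool → Bool → Bool → Bool → A)
    (left right : Fin R → Bool) (bottom top : Fin C → Bool) :
    partitionFunction W left right bottom top =
      partitionFunction (fun (i : Fin C) (j : Fin R) a b a' b' => W j.rev i b' (!a) b (!a'))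
        (fun i => !(bottom i)) (fun i => !(top i)) (fun j => right j.rev)
        (fun j => left j.rev) := by
  have conserves_rotate (a b a' b' : Bool) :
      Conserves (!b) a' (!b') a ↔ Conserves a b a' b' := by
    revert a b a' b'; decide
  have forall_rev (p : Fin R → Prop) : (∀ i : Fin R, p i.rev) ↔ ∀ i, p i :=
    Fin.rev_surjective.forall.symm
  refine Finset.sum_equiv (rotateConfiguration R C) (fun c => ?_) fun c _ => ?_
  · simp only [validConfigurations, Finset.mem_filter, Finset.mem_univ, true_and,
      rotateConfiguration, Equiv.coe_fn_mk, Fin.rev_zero, Fin.rev_last, Bool.not_inj_iff,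
      Fin.rev_castSucc, Fin.rev_succ, conserves_rotate]
    rw [forall_comm (α := Fin C), forall_rev fun i => c.1 i (Fin.last C) = right i,
      forall_rev fun i => c.1 i 0 = left i, forall_rev fun i => ∀ j,
        Conserves (c.1 i j.castSucc) (c.2 i.succ j) (c.1 i j.succ) (c.2 i.castSucc j)]
    tauto
  · simp only [rotateConfiguration, Equiv.coe_fn_mk, Bool.not_not,
      Fin.rev_castSucc, Fin.rev_succ]
    rw [Finset.prod_comm]
    refine Finset.prod_congr rfl fun j _ => ?_
    exact (Equiv.prod_comp Fin.revPerm fun i =>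
      W i j (c.1 i j.castSucc) (c.2 i.succ j) (c.1 i j.succ) (c.2 i.castSucc j)).symm

end PartitionFunctions

section CrossingWeights

open PuzzleLabel

/-- The weight of the crossing of a row of a puzzle with a line of parameter `x`: all pairs of
labels interact as in the six-vertex model, up to normalization by `s`. -/
def rowCrossingWeight {A : Type*} [CommRing A] (s q x : A) :
    PuzzleLabel → PuzzleLabel → PuzzleLabel → PuzzleLabel → A
  | red, red, red, red => s * (1 - q * x)
  | blue, blue, blue, blue => s * (1 - q * x)
  | white, white, white, white => s * (1 - q * x)
  | blue, red, blue, red => s * (1 - x)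
  | red, blue, red, blue => s * (q * (1 - x))
  | blue, red, red, blue => s * ((1 - q) * x)
  | red, blue, blue, red => s * (1 - q)
  | blue, white, blue, white => s * (1 - x)
  | white, blue, white, blue => s * (q * (1 - x))
  | blue, white, white, blue => s * ((1 - q) * x)
  | white, blue, blue, white => s * (1 - q)
  | red, white, red, white => s * (1 - x)
  | white, red, white, red => s * (q * (1 - x))
  | white, red, red, white => s * (1 - q)
  | red, white, white, red => s * ((1 - q) * x)
  | _, _, _, _ => 0

/-- The weight of the crossing of a line of parameter `x` with a column of a puzzle, up to
normalization by `s`. On the labels white and red it is a rotated six-vertex weight; the weights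
involving blue are chosen so as to satisfy the Yang–Baxter equation. -/
def columnCrossingWeight {A : Type*} [CommRing A] (s q x : A) :
    PuzzleLabel → PuzzleLabel → PuzzleLabel → PuzzleLabel → A
  | white, white, white, white => s * (1 - x)
  | red, red, red, red => s * (q * (1 - x))
  | blue, blue, blue, blue => s * (q * (1 - x))
  | white, red, white, red => s * (1 - q * x)
  | red, white, red, white => s * (1 - q * x)
  | white, red, red, white => s * ((1 - q) * x)
  | red, white, white, red => s * (1 - q)
  | blue, red, blue, red => s * (1 - q * x)
  | red, blue, red, blue => s * (q * (1 - q * x))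
  | blue, red, red, blue => s * (-(1 - q))
  | red, blue, blue, red => s * (-((1 - q) * x * q))
  | blue, white, blue, white => s * (1 - q * x)
  | white, blue, white, blue => s * (1 - q * x)
  | blue, white, white, blue => s * (1 - q)
  | white, blue, blue, white => s * ((1 - q) * x)
  | _, _, _, _ => 0

theorem PuzzleLabel.sum_univ {A : Type*} [AddCommMonoid A] (f : PuzzleLabel → A) :
    ∑ a, f a = f white + f red + f blue := by
  change ∑ a ∈ ({white, red, blue} : Finset PuzzleLabel), f a = _
  rw [Finset.sum_insert (by decide), Finset.sum_insert (by decide), Finset.sum_singleton,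
    add_assoc]

variable {A : Type*} [CommRing A]

theorem conserving_tileWeight (q : A) : Conserving (tileWeight q) := by
  intro a b a' b'
  cases a <;> cases b <;> cases a' <;> cases b' <;>
    first | exact fun _ => by decide | exact fun h => absurd rfl h

theorem conserving_rowCrossingWeight (s q x : A) : Conserving (rowCrossingWeight s q x) := by
  intro a b a' b'
  cases a <;> cases b <;> cases a' <;> cases b' <;>
    first | exact fun _ => by decide | exact fun h => absurd rfl h

theorem conserving_columnCrossingWeight (s q x : A) :
    Conserving (columnCrossingWeight s q x) := by
  intro a b a' b'
  cases a <;> cases b <;> cases a' <;> cases b' <;>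
    first | exact fun _ => by decide | exact fun h => absurd rfl h

theorem YangBaxter.of_conserving {A : Type*} [CommSemiring A] {α : Type*} [Fintype α]
    [DecidableEq α] {U V W : α → α → α → α → A} (hU : Conserving U) (hV : Conserving V)
    (hW : Conserving W)
    (h : ∀ a x b a'' x'' b'',
      (∀ X, labelIndicator X a + labelIndicator X x + labelIndicator X b =
        labelIndicator X a'' + labelIndicator X x'' + labelIndicator X b'') →
      ∑ a', ∑ x', ∑ b', U a x a' x' * V a' b a'' b' * W x' b' x'' b'' =
      ∑ a', ∑ x', ∑ b', W x b x' b' * V a b' a' b'' * U a' x' a'' x'') :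
    YangBaxter U V W := by
  intro a x b a'' x'' b''
  by_cases hc : ∀ X, labelIndicator X a + labelIndicator X x + labelIndicator X b =
      labelIndicator X a'' + labelIndicator X x'' + labelIndicator X b''
  · exact h _ _ _ _ _ _ hc
  · obtain ⟨X, hX⟩ := not_forall.mp hc
    have left_term (a' x' b') : U a x a' x' * V a' b a'' b' * W x' b' x'' b'' = 0 := by
      by_contra h0
      have hu := (hU _ _ _ _ (left_ne_zero_of_mul (left_ne_zero_of_mul h0))).labelIndicator X
      have hv := (hV _ _ _ _ (right_ne_zero_of_mul (left_ne_zero_of_mul h0))).labelIndicator X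
      have hw := (hW _ _ _ _ (right_ne_zero_of_mul h0)).labelIndicator X
      omega
    have right_term (a' x' b') : W x b x' b' * V a b' a' b'' * U a' x' a'' x'' = 0 := by
      by_contra h0
      have hw := (hW _ _ _ _ (left_ne_zero_of_mul (left_ne_zero_of_mul h0))).labelIndicator X
      have hv := (hV _ _ _ _ (right_ne_zero_of_mul (left_ne_zero_of_mul h0))).labelIndicator X
      have hu := (hU _ _ _ _ (right_ne_zero_of_mul h0)).labelIndicator X
      omega
    simp only [left_term, right_term, Finset.sum_const_zero]

set_option maxHeartbeats 1000000 in
-- Ninety-three boundaries satisfy conservation, and each gives a polynomial identity.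
theorem yangBaxter_puzzle (s q x : A) :
    YangBaxter (rowCrossingWeight s q x) (tileWeight q) (columnCrossingWeight s q x) := by
  refine YangBaxter.of_conserving (conserving_rowCrossingWeight s q x) (conserving_tileWeight q)
    (conserving_columnCrossingWeight s q x) fun a y b a' y' b' hc => ?_
  have hw := hc white
  have hr := hc red
  clear hc
  simp only [PuzzleLabel.sum_univ]
  cases a <;> cases y <;> cases b <;> cases a' <;> cases y' <;> cases b' <;>
    first
    | exact absurd hw (by decide)
    | exact absurd hr (by decide)
    | simp only [rowCrossingWeight, tileWeight, columnCrossingWeight, mul_zero, zero_mul, add_zero,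
        zero_add, mul_one] <;> ring

theorem redWhite_injective : Function.Injective redWhite := by decide

theorem redBlue_injective : Function.Injective redBlue := by decide

theorem whiteBlue_injective : Function.Injective whiteBlue := by decide

variable {K : Type*} [Field K] {q : K}

theorem vertexWeight_eq_redBlue (hq : q ≠ 0) {x : K} (hx : 1 - q * x ≠ 0) :
    vertexWeight q x q⁻¹ = fun a b a' b' =>
      rowCrossingWeight (1 - q * x)⁻¹ q x (redBlue a) (redBlue b) (redBlue a') (redBlue b') := by
  have hx' : 1 - x * q ≠ 0 := by rwa [mul_comm]
  funext a b a' b'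
  cases a <;> cases b <;> cases a' <;> cases b' <;>
    simp only [vertexWeight, rowCrossingWeight, redBlue, reduceIte, Bool.false_eq_true] <;>
    field_simp

theorem vertexWeight_eq_whiteBlue (hq : q ≠ 0) {x : K} (hx : 1 - q * x ≠ 0) :
    vertexWeight q x q⁻¹ = fun a b a' b' => rowCrossingWeight (1 - q * x)⁻¹ q x
      (whiteBlue a) (whiteBlue b) (whiteBlue a') (whiteBlue b') := by
  have hx' : 1 - x * q ≠ 0 := by rwa [mul_comm]
  funext a b a' b'
  cases a <;> cases b <;> cases a' <;> cases b' <;>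
    simp only [vertexWeight, rowCrossingWeight, whiteBlue, reduceIte, Bool.false_eq_true] <;>
    field_simp

theorem vertexWeight_rotate_eq_redWhite (hq : q ≠ 0) {x : K} (hx : 1 - q * x ≠ 0)
    (a b a' b' : Bool) :
    vertexWeight q x q⁻¹ b' (!a) b (!a') = columnCrossingWeight (1 - q * x)⁻¹ q x
      (redWhite a) (redWhite b) (redWhite a') (redWhite b') := by
  have hx' : 1 - x * q ≠ 0 := by rwa [mul_comm]
  cases a <;> cases b <;> cases a' <;> cases b' <;>
    simp only [vertexWeight, columnCrossingWeight, redWhite, reduceIte, Bool.false_eq_true,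
      Bool.not_true, Bool.not_false] <;>
    field_simp

end CrossingWeights

section ProductRule

open PuzzleLabel

/-- The partition function of puzzles with arbitrary boundary labels, at a value `q` of the
parameter. The boundaries come in the order left, bottom, right, top, as for the tiles. -/
def puzzlePartition {A : Type*} [CommRing A] {P N : ℕ} (q : A) (left : Fin P → PuzzleLabel)
    (bottom : Fin N → PuzzleLabel) (right : Fin P → PuzzleLabel) (top : Fin N → PuzzleLabel) : A :=
  partitionFunction (fun _ _ => tileWeight q) left right bottom top

/-- The partition function of the crossings of the rows of a puzzle with the lines of parameters
`x`, normalized so that crossings of lines with equal labels have weight one. -/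
def rowCrossings {K : Type*} [Field K] {P n : ℕ} (q : K) (x : Fin n → K)
    (left : Fin P → PuzzleLabel) (bottom : Fin n → PuzzleLabel) (right : Fin P → PuzzleLabel)
    (top : Fin n → PuzzleLabel) : K :=
  partitionFunction (fun _ k => rowCrossingWeight (1 - q * x k)⁻¹ q (x k)) left right bottom top

/-- The partition function of the crossings of the lines of parameters `x` with the columns of a
puzzle, with the same normalization factors as in `rowCrossings`. -/
def columnCrossings {K : Type*} [Field K] {n N : ℕ} (q : K) (x : Fin n → K)
    (left : Fin n → PuzzleLabel) (bottom : Fin N → PuzzleLabel) (right : Fin n → PuzzleLabel)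
    (top : Fin N → PuzzleLabel) : K :=
  partitionFunction (fun k _ => columnCrossingWeight (1 - q * x k)⁻¹ q (x k)) left right bottom top

theorem yangBaxter_puzzlePartition {K : Type*} [Field K] {P N n : ℕ} (q : K) (x : Fin n → K) :
    YangBaxter (rowCrossings (P := P) q x) (puzzlePartition q) (columnCrossings (N := N) q x) :=
  YangBaxter.partitionFunction (fun _ _ => conserving_rowCrossingWeight _ _ _)
    (fun _ _ => conserving_tileWeight q) (fun _ _ => conserving_columnCrossingWeight _ _ _)
    fun _ _ _ => yangBaxter_puzzle _ _ _

theorem aeval_puzzleCoeff {A : Type*} [CommRing A] {P N : ℕ} (q : A) (k : Fin P → Bool)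
    (w l : Fin N → Bool) (m : Fin P → Bool) :
    aeval q (puzzleCoeff k w l m) = puzzlePartition q (fun i => redBlue (m i))
      (fun j => redWhite (w j.rev)) (fun i => whiteBlue (k i)) (fun j => redWhite (l j.rev)) := by
  have aeval_tileWeight (a b a' b') :
      aeval q (tileWeight (X : ℤ[X]) a b a' b') = tileWeight q a b a' b' := by
    cases a <;> cases b <;> cases a' <;> cases b' <;>
      simp only [tileWeight, map_zero, map_one, map_neg, aeval_X]
  simp only [puzzleCoeff, puzzlePartition, partitionFunction, map_sum, map_prod, aeval_tileWeight]

theorem redWhite_ne_blue (b : Bool) : redWhite b ≠ blue := by cases b <;> decide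

theorem redBlue_ne_white (b : Bool) : redBlue b ≠ white := by cases b <;> decide

section Frozen

variable {A : Type*} [CommRing A] {P N n : ℕ}

theorem puzzlePartition_of_right_blue (q : A) {left : Fin P → PuzzleLabel}
    {bottom top : Fin N → PuzzleLabel} (hb : ∀ j, bottom j ≠ blue) :
    puzzlePartition q left bottom (fun _ => blue) top =
      if left = (fun _ => blue) ∧ bottom = top then 1 else 0 := by
  by_cases boundary : left = (fun _ => blue) ∧ ∀ j, top j ≠ blue
  · obtain ⟨rfl, ht⟩ := boundary
    have weight_one : ∀ y ≠ blue, tileWeight q blue y blue y = 1 := by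
      intro y hy
      cases y
      exacts [rfl, rfl, absurd rfl hy]
    simp only [puzzlePartition, partitionFunction_of_frozen (fun _ _ => weight_one) ht, true_and]
  · rw [if_neg fun h : left = _ ∧ bottom = top => boundary ⟨h.1, h.2 ▸ hb⟩]
    refine not_not.mp fun h0 => boundary ?_
    have count := labelCount_of_partitionFunction_ne_zero h0 blue
    rw [labelCount_eq_zero.mpr hb, labelCount_eq_length.mpr rfl] at count
    have left_le := labelCount_le blue left
    exact ⟨labelCount_eq_length.mp (by omega), labelCount_eq_zero.mp (by omega)⟩

theorem puzzlePartition_bottom_ne_blue {q : A} {m : Fin P → Bool} {l : Fin N → Bool}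
    (h : ∀ (i : Fin P) (j : Fin N), m i = true → l j = true → (i + 1 : ℕ) + (j + 1 : ℕ) ≤ P)
    {bottom : Fin N → PuzzleLabel} {right : Fin P → PuzzleLabel}
    (h0 : puzzlePartition q (fun i => redBlue (m i)) bottom right
      (fun j => redWhite (l j.rev)) ≠ 0) : ∀ j, bottom j ≠ blue := by
  obtain ⟨c, hc, hW⟩ := exists_configuration_of_partitionFunction_ne_zero h0
  refine bottom_ne_of_left_eventually_eq hc (Y := white) (fun i j hh hv => hW i j ?_) (by decide)
    (fun i => redBlue_ne_white _) (fun j => redWhite_ne_blue _) fun i j hi hj => ?_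
  · rw [hh, hv]
    cases c.1 i j.succ <;> cases c.2 i.castSucc j <;> rfl
  · have hm : m i = true := by_contra fun hm => hi (if_neg hm)
    have hl : l j.rev = true := by_contra fun hl => hj (if_neg hl)
    have := h i j.rev hm hl
    rw [Fin.val_rev] at this
    omega

end Frozen

variable {K : Type*} [Field K] {P N n : ℕ} {q : K} {x : Fin n → K}

theorem waveFunction_eq_redBlue (hq : q ≠ 0) (hx : ∀ i, 1 - q * x i ≠ 0) (m : Fin P → Bool) :
    waveFunction q m x = rowCrossings q x (fun i => redBlue (m i)) (fun _ => blue)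
      (fun _ => blue) (fun _ => red) := by
  simp only [waveFunction, skewWaveFunction, waveFunctionXY, vertexWeight_eq_redBlue hq (hx _)]
  exact partitionFunction_map redBlue_injective ..

theorem waveFunction_eq_whiteBlue (hq : q ≠ 0) (hx : ∀ i, 1 - q * x i ≠ 0) (m : Fin P → Bool) :
    waveFunction q m x = rowCrossings q x (fun i => whiteBlue (m i)) (fun _ => blue)
      (fun _ => blue) (fun _ => white) := by
  simp only [waveFunction, skewWaveFunction, waveFunctionXY, vertexWeight_eq_whiteBlue hq (hx _)]
  exact partitionFunction_map whiteBlue_injective ..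

theorem skewWaveFunction_eq_redWhite (hq : q ≠ 0) (hx : ∀ i, 1 - q * x i ≠ 0)
    (l w : Fin N → Bool) :
    skewWaveFunction q l w x = columnCrossings q x (fun _ => red) (fun j => redWhite (w j.rev))
      (fun _ => white) (fun j => redWhite (l j.rev)) := by
  rw [skewWaveFunction, waveFunctionXY, partitionFunction_rotate]
  simp only [vertexWeight_rotate_eq_redWhite hq (hx _)]
  exact partitionFunction_map redWhite_injective ..

theorem columnCrossings_of_left_blue (hx : ∀ i, 1 - q * x i ≠ 0) {right : Fin n → PuzzleLabel}
    {bottom top : Fin N → PuzzleLabel} (ht : ∀ j, top j ≠ blue) :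
    columnCrossings q x (fun _ => blue) bottom right top =
      if right = (fun _ => blue) ∧ bottom = top then 1 else 0 := by
  refine partitionFunction_of_frozen (fun k _ y hy => ?_) ht
  cases y
  exacts [inv_mul_cancel₀ (hx k), inv_mul_cancel₀ (hx k), absurd rfl hy]

theorem numParticles_eq_labelCount (m : Fin P → Bool) : numParticles m = labelCount true m :=
  (labelCount_eq_card true m).symm

theorem numParticles_of_waveFunction_ne_zero {m : Fin P → Bool} (h : waveFunction q m x ≠ 0) :
    numParticles m = n := by
  have count := labelCount_of_partitionFunction_ne_zero h true
  rw [labelCount_const_of_ne (by decide), labelCount_const_of_ne (by decide),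
    labelCount_eq_length.mpr rfl, ← numParticles_eq_labelCount] at count
  omega

theorem top_eq_red_of_rowCrossings_ne_zero {m : Fin P → Bool} (hm : numParticles m = n)
    {top : Fin n → PuzzleLabel} (h : rowCrossings q x (fun i => redBlue (m i)) (fun _ => blue)
      (fun _ => blue) top ≠ 0) : top = fun _ => red := by
  have count := labelCount_of_partitionFunction_ne_zero h red
  have left_count : labelCount red (fun i => redBlue (m i)) = labelCount true m :=
    labelCount_map redBlue_injective true m
  rw [left_count, ← numParticles_eq_labelCount, hm, labelCount_const_of_ne (by decide),
    labelCount_const_of_ne (by decide)] at count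
  exact labelCount_eq_length.mp (by omega)

theorem left_mem_range_of_rowCrossings_ne_zero {left : Fin P → PuzzleLabel}
    (h : rowCrossings q x left (fun _ => blue) (fun _ => blue) (fun _ => white) ≠ 0) :
    left ∈ Set.range fun (k : Fin P → Bool) i => whiteBlue (k i) := by
  have count := labelCount_of_partitionFunction_ne_zero h red
  rw [labelCount_const_of_ne (by decide), labelCount_const_of_ne (by decide),
    labelCount_const_of_ne (by decide)] at count
  have left_ne_red := labelCount_eq_zero.mp count
  have mem_range : ∀ a ≠ red, ∃ b, whiteBlue b = a := by decide
  choose k hk using fun i => mem_range (left i) (left_ne_red i)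
  exact ⟨k, funext hk⟩

theorem sum_rowCrossings_mul_puzzlePartition {m : Fin P → Bool} (w l : Fin N → Bool)
    (hm : numParticles m = n) (hq : q ≠ 0) (hx : ∀ i, 1 - q * x i ≠ 0) :
    ∑ a', ∑ x', ∑ b', rowCrossings q x (fun i => redBlue (m i)) (fun _ => blue) a' x' *
        puzzlePartition q a' (fun j => redWhite (w j.rev)) (fun _ => blue) b' *
        columnCrossings q x x' b' (fun _ => white) (fun j => redWhite (l j.rev)) =
      waveFunction q m x * skewWaveFunction q l w x := by
  have frozen (a' : Fin P → PuzzleLabel) (b') := puzzlePartition_of_right_blue q (left := a')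
    (top := b') fun j => redWhite_ne_blue (w j.rev)
  simp only [frozen, ite_and, mul_ite, mul_one, mul_zero, ite_mul, zero_mul,
    Finset.sum_ite_irrel, Finset.sum_const_zero, Finset.sum_ite_eq, Finset.sum_ite_eq',
    Finset.mem_univ, if_true]
  rw [Fintype.sum_eq_single (fun _ => red) fun x' hx' => ?_, waveFunction_eq_redBlue hq hx,
    skewWaveFunction_eq_redWhite hq hx]
  rw [not_not.mp (mt (top_eq_red_of_rowCrossings_ne_zero hm) hx'), zero_mul]

theorem sum_columnCrossings_mul_puzzlePartition {m : Fin P → Bool} {w l : Fin N → Bool}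
    (h : ∀ (i : Fin P) (j : Fin N), m i = true → l j = true → (i + 1 : ℕ) + (j + 1 : ℕ) ≤ P)
    (hq : q ≠ 0) (hx : ∀ i, 1 - q * x i ≠ 0) :
    ∑ a', ∑ x', ∑ b', columnCrossings q x (fun _ => blue) (fun j => redWhite (w j.rev)) x' b' *
        puzzlePartition q (fun i => redBlue (m i)) b' a' (fun j => redWhite (l j.rev)) *
        rowCrossings q x a' x' (fun _ => blue) (fun _ => white) =
      ∑ k : Fin P → Bool, aeval q (puzzleCoeff k w l m) * waveFunction q k x := by
  have frozen (a' : Fin P → PuzzleLabel) (x' b') :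
      columnCrossings q x (fun _ => blue) (fun j => redWhite (w j.rev)) x' b' *
          puzzlePartition q (fun i => redBlue (m i)) b' a' (fun j => redWhite (l j.rev)) =
        if x' = (fun _ => blue) ∧ (fun j => redWhite (w j.rev)) = b' then
          puzzlePartition q (fun i => redBlue (m i)) b' a' (fun j => redWhite (l j.rev))
        else 0 := by
    by_cases h0 : puzzlePartition q (fun i => redBlue (m i)) b' a'
      (fun j => redWhite (l j.rev)) = 0
    · rw [h0, mul_zero, ite_self]
    · rw [columnCrossings_of_left_blue hx (puzzlePartition_bottom_ne_blue h h0), ite_mul, one_mul,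
        zero_mul]
  simp only [frozen, ite_and, ite_mul, zero_mul, Finset.sum_ite_irrel, Finset.sum_const_zero,
    Finset.sum_ite_eq, Finset.sum_ite_eq', Finset.mem_univ, if_true]
  refine (Fintype.sum_of_injective (fun (k : Fin P → Bool) i => whiteBlue (k i))
    (fun _ _ hk => funext fun i => whiteBlue_injective (congrFun hk i)) _ _ (fun a' ha' => ?_)
    fun k => ?_).symm
  · rw [not_not.mp (mt left_mem_range_of_rowCrossings_ne_zero ha'), mul_zero]
  · rw [aeval_puzzleCoeff, waveFunction_eq_whiteBlue hq hx]

theorem waveFunction_mul_skewWaveFunction {m : Fin P → Bool} {w l : Fin N → Bool}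
    (hm : numParticles m = n)
    (h : ∀ (i : Fin P) (j : Fin N), m i = true → l j = true → (i + 1 : ℕ) + (j + 1 : ℕ) ≤ P)
    (hq : q ≠ 0) (hx : ∀ i, 1 - q * x i ≠ 0) :
    waveFunction q m x * skewWaveFunction q l w x =
      ∑ k : Fin P → Bool with numParticles k = n,
        aeval q (puzzleCoeff k w l m) * waveFunction q k x := by
  rw [← sum_rowCrossings_mul_puzzlePartition w l hm hq hx, yangBaxter_puzzlePartition,
    sum_columnCrossings_mul_puzzlePartition h hq hx]
  refine (Finset.sum_filter_of_ne fun k _ hk => ?_).symm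
  exact numParticles_of_waveFunction_ne_zero (right_ne_zero_of_mul hk)

end ProductRule

section SignPositivity

open PuzzleLabel

/-- The polynomial `p`, multiplied by the sign of parity `e`, has non-negative coefficients. -/
def HasSign (e : ZMod 2) (p : ℤ[X]) : Prop :=
  ∀ d, 0 ≤ (((-1 : ℤˣ) ^ e : ℤˣ) : ℤ) * p.coeff d

namespace HasSign

theorem zero (e : ZMod 2) : HasSign e 0 := fun d => by simp

theorem one : HasSign 0 1 := fun d => by
  rw [uzpow_zero, Units.val_one, one_mul, coeff_one]
  split_ifs <;> norm_num

protected theorem X : HasSign 0 X := fun d => by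
  rw [uzpow_zero, Units.val_one, one_mul, coeff_X]
  split_ifs <;> norm_num

theorem neg {p : ℤ[X]} {e : ZMod 2} (hp : HasSign e p) : HasSign (e + 1) (-p) := fun d => by
  simpa [uzpow_add] using hp d

theorem mul {e f : ZMod 2} {p r : ℤ[X]} (hp : HasSign e p) (hr : HasSign f r) :
    HasSign (e + f) (p * r) := fun d => by
  rw [coeff_mul, uzpow_add, Units.val_mul, Finset.mul_sum]
  refine Finset.sum_nonneg fun i _ => ?_
  rw [mul_mul_mul_comm]
  exact mul_nonneg (hp _) (hr _)

theorem prod {ι : Type*} {s : Finset ι} {e : ι → ZMod 2} {p : ι → ℤ[X]}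
    (h : ∀ i ∈ s, HasSign (e i) (p i)) : HasSign (∑ i ∈ s, e i) (∏ i ∈ s, p i) := by
  induction s using Finset.cons_induction with
  | empty => exact one
  | cons i s hi ih =>
    rw [Finset.sum_cons, Finset.prod_cons]
    exact (h i (Finset.mem_cons_self i s)).mul
      (ih fun j hj => h j (Finset.mem_cons_of_mem hj))

theorem sum {ι : Type*} {s : Finset ι} {e : ZMod 2} {p : ι → ℤ[X]}
    (h : ∀ i ∈ s, HasSign e (p i)) : HasSign e (∑ i ∈ s, p i) := fun d => by
  rw [finsetSum_coeff, Finset.mul_sum]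
  exact Finset.sum_nonneg fun i hi => h i hi d

end HasSign

/-- The parity of the sign of a tile, in a form which is additive along rows. -/
def tileParity (a b a' b' : PuzzleLabel) : ZMod 2 :=
  1 + labelIndicator white a + labelIndicator white b +
    labelIndicator blue a * labelIndicator red b + labelIndicator blue b' * labelIndicator red a'

theorem hasSign_tileWeight (a b a' b' : PuzzleLabel) :
    HasSign (tileParity a b a' b') (tileWeight X a b a' b') := by
  cases a <;> cases b <;> cases a' <;> cases b' <;>
    first
    | exact HasSign.zero _
    | exact HasSign.one
    | exact HasSign.X
    | exact HasSign.one.neg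
    | exact HasSign.X.neg

/-- The parity of the number of pairs of a blue label followed by a red one, plus the sum of the
positions, counted from the end, of the white labels. -/
def stringParity : ∀ {n : ℕ}, (Fin n → PuzzleLabel) → ZMod 2
  | 0, _ => 0
  | n + 1, u => labelIndicator blue (u 0) * labelCount red (fun i => u i.succ) +
      n * labelIndicator white (u 0) + stringParity fun i => u i.succ

theorem ConservesRow.sum_tileParity {n : ℕ} {h : Fin (n + 1) → PuzzleLabel}
    {bottom top : Fin n → PuzzleLabel} (hc : ConservesRow h bottom top) :
    ∑ j, tileParity (h j.castSucc) (bottom j) (h j.succ) (top j) =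
      stringParity bottom + stringParity top + n + n * labelIndicator white (h 0) +
        labelCount white bottom + labelIndicator blue (h 0) * labelCount red bottom +
        labelCount blue top * labelIndicator red (h (Fin.last n)) := by
  induction n with
  | zero => simp [stringParity, labelCount]
  | succ n ih =>
    have tail : ConservesRow (fun j => h j.succ) (fun j => bottom j.succ) fun j => top j.succ :=
      fun j => hc j.succ
    have blue_count := congrArg (Nat.cast : ℕ → ZMod 2) ((hc 0).labelIndicator blue)
    have white_count := congrArg (Nat.cast : ℕ → ZMod 2) ((hc 0).labelIndicator white)
    have red_count := congrArg (Nat.cast : ℕ → ZMod 2) (tail.labelCount red)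
    have tail_parity := ih tail
    simp only [Nat.cast_add, Fin.castSucc_zero, Fin.succ_last] at blue_count white_count red_count
    simp only [Fin.succ_castSucc, Fin.succ_last] at tail_parity
    rw [Fin.sum_univ_succ, tail_parity]
    simp only [tileParity, stringParity, labelCount_succ, Nat.cast_succ, Nat.cast_add,
      Fin.castSucc_zero]
    linear_combination
      -(labelCount red fun j => bottom j.succ : ZMod 2) * blue_count - (n : ZMod 2) * white_count +
      (labelIndicator blue (top 0) : ZMod 2) * red_count -
      CharTwo.add_self_eq_zero ((labelIndicator blue (top 0) : ZMod 2) *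
        (labelCount red fun j => bottom j.succ) + n * labelIndicator white (top 0))

/-- The parity of the sign of a puzzle. -/
def puzzleParity {R C : ℕ} (c : EdgeLabelling PuzzleLabel R C) : ZMod 2 :=
  ∑ i, ∑ j, tileParity (c.1 i j.castSucc) (c.2 i.succ j) (c.1 i j.succ) (c.2 i.castSucc j)

variable {R C : ℕ} {left right : Fin R → PuzzleLabel} {bottom top : Fin C → PuzzleLabel}
  {c d : EdgeLabelling PuzzleLabel R C}

theorem puzzleParity_eq (hc : c ∈ validConfigurations left right bottom top)
    (hd : d ∈ validConfigurations left right bottom top) : puzzleParity c = puzzleParity d := by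
  have count := labelCount_vertical_eq hc hd
  obtain ⟨c_left, c_right, c_bottom, c_top, c_rows⟩ := mem_validConfigurations.mp hc
  obtain ⟨d_left, d_right, d_bottom, d_top, d_rows⟩ := mem_validConfigurations.mp hd
  have lattice := add_sum_eq_add_sum_of_step
    (f := fun i => stringParity (c.2 i) + stringParity (d.2 i))
    (g := fun i => ∑ j, tileParity (c.1 i j.castSucc) (c.2 i.succ j) (c.1 i j.succ)
      (c.2 i.castSucc j))
    (g' := fun i => ∑ j, tileParity (d.1 i j.castSucc) (d.2 i.succ j) (d.1 i j.succ)
      (d.2 i.castSucc j)) fun i => by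
    rw [(c_rows i).sum_tileParity, (d_rows i).sum_tileParity, c_left, c_right, d_left, d_right]
    simp only [count]
    linear_combination CharTwo.add_self_eq_zero (stringParity (c.2 i.castSucc)) -
      CharTwo.add_self_eq_zero (stringParity (d.2 i.succ))
  simpa only [puzzleParity, c_top, d_top, c_bottom, d_bottom, CharTwo.add_self_eq_zero, zero_add]
    using lattice

theorem exists_hasSign_partitionFunction_tileWeight (left right : Fin R → PuzzleLabel)
    (bottom top : Fin C → PuzzleLabel) : ∃ e, HasSign e
      (partitionFunction (fun _ _ => tileWeight (X : ℤ[X])) left right bottom top) := by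
  rcases (validConfigurations left right bottom top).eq_empty_or_nonempty with empty | ⟨d, hd⟩
  · rw [partitionFunction, empty]
    exact ⟨0, HasSign.zero 0⟩
  · refine ⟨puzzleParity d, HasSign.sum fun c hc => ?_⟩
    rw [puzzleParity_eq hd hc]
    exact HasSign.prod fun i _ => HasSign.prod fun j _ => hasSign_tileWeight _ _ _ _

end SignPositivity

/-- The product rule for six-vertex wavefunctions, in every field `K` and at every point where the
wavefunctions have no pole (so in particular as an identity of rational functions in `q` and the
`xᵢ`), and the sign-positivity of the coefficients. The hypothesis in the product rule says that the
string `m` is followed by enough holes: with 1-based indices, `i + j ≤ P` whenever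
`mᵢ = lⱼ = 1`. -/
theorem theorem3p3 (P N n : ℕ) (m : Fin P → Bool) (w l : Fin N → Bool)
    (hm : numParticles m = n) (hl : numParticles l = numParticles w + n) :
    ((∀ (i : Fin P) (j : Fin N), m i = true → l j = true → (i + 1 : ℕ) + (j + 1 : ℕ) ≤ P) →
      ∀ (K : Type*) [Field K] (q : K) (x : Fin n → K), q ≠ 0 → (∀ i, q * x i ≠ 1) →
        waveFunction q m x * skewWaveFunction q l w x =
          ∑ k : Fin P → Bool with numParticles k = n,
            aeval q (puzzleCoeff k w l m) * waveFunction q k x) ∧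
    ∀ k : Fin P → Bool, ∃ ε : ℤ, (ε = 1 ∨ ε = -1) ∧
      ∀ d : ℕ, 0 ≤ ε * (puzzleCoeff k w l m).coeff d := by
  refine ⟨fun h K _ q x hq hx => ?_, fun k => ?_⟩
  · exact waveFunction_mul_skewWaveFunction hm h hq fun i => sub_ne_zero.mpr (hx i).symm
  · obtain ⟨e, he⟩ := exists_hasSign_partitionFunction_tileWeight ..
    exact ⟨((-1 : ℤˣ) ^ e : ℤˣ), Int.isUnit_iff.mp (Units.isUnit _), he⟩
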